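/- Let $T,\theta,\sigma>0$ and $\sigma_0\ge 0$. Let $G=(G_t)_{t\in[0,T]}$ be a centered Ornstein–Uhlenbeck process, i.e. a process with a.s. continuous paths such that almost surely $$G_t=G_0-\theta\int_0^t G_s\,ds+\sigma W_t\qquad\text{for all } t\in[0,T],$$ where $W$ is a standard Brownian motion on $[0,T]$ and $G_0\sim\mathcal N(0,\sigma_0^2)$ is independent of $W$ (with $G_0=0$ a.s. if $\sigma_0=0$). For a step function $f=\sum_{i} c_i\mathbf 1_{(s_i,t_i]}$ on $[0,T]$ (a finite sum with $0\le s_i\le t_i\le T$) put $\int_0^T f\,dG:=\sum_i c_i\,(G_{t_i}-G_{s_i})$. For $g\in L^2([0,T])$ the Wiener integral $\int_0^T g\,dG$ is a square integrable random variable that is the $L^2(\mathbb P)$-limit of $\int_0^T f_n\,dG$ along some sequence of step functions $f_n$ with $f_n\to g$ in $L^2([0,T])$. Then for every $g\in L^2([0,T])$ the Wiener integral $\int_0^T g\,dG$ is well defined (such a limit exists along some sequence, and any two such limits, possibly along different sequences, are almost surely equal), and $$\int_0^T g(s)\,dG_s=0\ \text{ a.s.}\quad\Longleftrightarrow\quad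 g=0\ \text{ in } L^2([0,T]).$$ -/

import Mathlib

open MeasureTheory ProbabilityTheory Filter Topology
open scoped NNReal ENNReal

noncomputable section

namespace OUWiener

variable {Ω : Type*} [MeasurableSpace Ω]

/-- `W` is a standard Brownian motion on the time interval `[0,T]`: a centered Gaussian process
with covariance `min s t` and almost surely continuous paths. The values of `W` outside `[0,T]`
play no role. -/
structure IsBrownianMotionOn (T : ℝ) (W : ℝ → Ω → ℝ) (P : Measure Ω) : Prop where
  isGaussianProcess : IsGaussianProcess (fun (t : Set.Icc (0 : ℝ) T) ω ↦ W t ω) P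
  mean_zero : ∀ t ∈ Set.Icc 0 T, ∫ ω, W t ω ∂P = 0
  covariance : ∀ s ∈ Set.Icc 0 T, ∀ t ∈ Set.Icc 0 T, cov[W s, W t; P] = min s t
  continuousOn : ∀ᵐ ω ∂P, ContinuousOn (fun t ↦ W t ω) (Set.Icc 0 T)

/-- `G` is a centered Ornstein-Uhlenbeck process on `[0,T]` driven by `W`, that is, a solution with
continuous paths of `dG = -θ G dt + σ dW` (in integrated form) whose initial value has law
`N(0, σ₀²)` (a Dirac mass at `0` if `σ₀ = 0`) and is independent of `(W t)_{t ∈ [0,T]}`. -/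
structure IsOrnsteinUhlenbeck (θ σ : ℝ) (σ₀ : ℝ≥0) (T : ℝ) (W G : ℝ → Ω → ℝ) (P : Measure Ω) :
    Prop where
  aemeasurable : ∀ t ∈ Set.Icc 0 T, AEMeasurable (G t) P
  continuousOn : ∀ᵐ ω ∂P, ContinuousOn (fun t ↦ G t ω) (Set.Icc 0 T)
  initial_law : HasLaw (G 0) (gaussianReal 0 (σ₀ ^ 2)) P
  initial_indep : IndepFun (G 0) (fun ω (t : Set.Icc (0 : ℝ) T) ↦ W t ω) P
  sde : ∀ᵐ ω ∂P, ∀ t ∈ Set.Icc 0 T,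
    G t ω = G 0 ω - θ * (∫ s in (0 : ℝ)..t, G s ω) + σ * W t ω

/-- A step function on `[0,T]`, written as a finite linear combination
`∑ i, coeff i • 1_{(left i, right i]}` of indicators of subintervals of `[0,T]`. -/
structure StepFunction (T : ℝ) where
  n : ℕ
  coeff : Fin n → ℝ
  left : Fin n → ℝ
  right : Fin n → ℝ
  zero_le_left : ∀ i, 0 ≤ left i
  left_le_right : ∀ i, left i ≤ right i
  right_le : ∀ i, right i ≤ T

namespace StepFunction

variable {T : ℝ}

/-- The function represented by a step function. -/
def toFun (f : StepFunction T) (x : ℝ) : ℝ :=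
  ∑ i, f.coeff i * (Set.Ioc (f.left i) (f.right i)).indicator (fun _ ↦ (1 : ℝ)) x

/-- The elementary integral `∫₀ᵀ f dX = ∑ i, coeff i * (X (right i) - X (left i))`. -/
def integral (f : StepFunction T) (X : ℝ → Ω → ℝ) (ω : Ω) : ℝ :=
  ∑ i, f.coeff i * (X (f.right i) ω - X (f.left i) ω)

end StepFunction

/-- `Z` is (a version of) the Wiener integral `∫₀ᵀ g dX`: a square integrable random variable that
is the `L²(P)`-limit of the elementary integrals `∫₀ᵀ fₙ dX` along some sequence of step functions
`fₙ` that converges to `g` in `L²([0,T])`. -/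
def IsWienerIntegral (T : ℝ) (X : ℝ → Ω → ℝ) (P : Measure Ω) (g : ℝ → ℝ) (Z : Ω → ℝ) : Prop :=
  MemLp Z 2 P ∧ ∃ f : ℕ → StepFunction T,
    Tendsto (fun n ↦ eLpNorm (fun x ↦ (f n).toFun x - g x) 2 (volume.restrict (Set.Icc 0 T)))
      atTop (𝓝 0) ∧
    Tendsto (fun n ↦ eLpNorm (fun ω ↦ (f n).integral X ω - Z ω) 2 P) atTop (𝓝 0)

end OUWiener

end

/-! Everything takes place in `L²(P)`. By variation of constants, `G t = x t - θ e^{-θt} ∫₀ᵗ e^{θs}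
x s ds` with `x t = G 0 + σ W t`, and the integral may be read as a Bochner integral in `L²(P)`
(`IsOrnsteinUhlenbeck.exists_ouPath`).

Well-definedness: elementary integrals against `W` are isometric, because `W` and the indicators
`1_{(-∞,t]}` in `L²([0,T])` share the covariance `min s t`; the drift is a `C¹` path in `L²(P)`, so
its elementary integrals are bounded in the `L²` norm. Hence `f ↦ ∫ f dG` is bounded on step
functions (`exists_norm_increments_ouPath_le`), which are dense.

Injectivity needs no lower bound on the norm. Pairing with `W t` gives `E[W t ∫ f dG] = ⟨f, k_t⟩`,
where `k_t` (`covDensity`) is the density of `b ↦ Cov(G b, W t)` (`inner_ouPath`,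
`inner_indPath_covDensity`). If `∫ g dG = 0`, then `g` is orthogonal to every `k_t`. With `F t = ∫₀ᵗ
e^{-θs} g s ds` this reads `e^{θt} F t = (e^{θt} - 1) F T`; taking `t = T` yields `F T = 0`, so `F =
0` and `g = 0` a.e. (`L2Icc_eq_zero_of_inner_covDensity`). -/

noncomputable section

namespace OUWiener

/-! ### Riemann sums, the linear integral equation, explicit integrals -/

section RealAnalysis

variable {E : Type*} [NormedAddCommGroup E] [NormedSpace ℝ E]

/-- Left-endpoint Riemann sums of a continuous function converge to its integral. -/
theorem tendsto_riemannSum [CompleteSpace E] {f : ℝ → E} {t : ℝ} (ht : 0 ≤ t)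
    (hf : ContinuousOn f (Set.Icc 0 t)) :
    Tendsto (fun n : ℕ ↦ ∑ k ∈ Finset.range n, (t / n) • f (k * (t / n))) atTop
      (𝓝 (∫ s in (0 : ℝ)..t, f s)) := by
  rw [Metric.tendsto_atTop]
  intro ε hε
  have huc := isCompact_Icc.uniformContinuousOn_of_continuous hf
  rw [Metric.uniformContinuousOn_iff] at huc
  -- Dividing by `t + 1` rather than `t` covers `t = 0` and makes the final inequality strict.
  obtain ⟨δ, hδ, huc⟩ := huc (ε / (t + 1)) (by positivity)
  obtain ⟨N, hN⟩ := exists_nat_gt (t / δ)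
  refine ⟨N + 1, fun n hn ↦ ?_⟩
  have hn0 : (0 : ℝ) < n := by exact_mod_cast (by omega : 0 < n)
  have hNn : (N : ℝ) ≤ n := by exact_mod_cast (by omega : N ≤ n)
  set h := t / n with hh
  have hh0 : 0 ≤ h := by positivity
  have hnh : n * h = t := by rw [hh]; field_simp
  have hhδ : h < δ := by
    rw [hh, div_lt_iff₀ hn0]
    rw [div_lt_iff₀ hδ] at hN
    nlinarith
  have hmem : ∀ k < n, ∀ s ∈ Set.Icc (k * h) ((k + 1 : ℕ) * h), s ∈ Set.Icc 0 t := by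
    intro k hk s hs
    have : ((k + 1 : ℕ) : ℝ) ≤ n := by exact_mod_cast hk
    refine ⟨le_trans (by positivity) hs.1, hs.2.trans ?_⟩
    rw [← hnh]; gcongr
  have hle : ∀ k : ℕ, (k : ℝ) * h ≤ (k + 1 : ℕ) * h := fun k ↦ by push_cast; nlinarith
  have hint : ∀ k < n, IntervalIntegrable f volume (k * h) ((k + 1 : ℕ) * h) := fun k hk ↦ by
    apply ContinuousOn.intervalIntegrable
    rw [Set.uIcc_of_le (hle k)]
    exact hf.mono fun s hs ↦ hmem k hk s hs
  have hsum := intervalIntegral.sum_integral_adjacent_intervals (a := fun k : ℕ ↦ (k : ℝ) * h) hint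
  simp only [Nat.cast_zero, zero_mul, hnh] at hsum
  rw [← hsum, dist_eq_norm, ← Finset.sum_sub_distrib]
  have hterm : ∀ k ∈ Finset.range n,
      ‖h • f (k * h) - ∫ s in (k * h)..((k + 1 : ℕ) * h), f s‖ ≤ ε / (t + 1) * h := by
    intro k hk
    rw [Finset.mem_range] at hk
    have hlen : ((k + 1 : ℕ) : ℝ) * h - k * h = h := by push_cast; ring
    have hc : h • f (k * h) = ∫ _ in (k * h)..((k + 1 : ℕ) * h), f (k * h) := by
      rw [intervalIntegral.integral_const, hlen]
    rw [hc, ← intervalIntegral.integral_sub intervalIntegrable_const (hint k hk)]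
    refine (intervalIntegral.norm_integral_le_of_norm_le_const (C := ε / (t + 1))
      fun s hs ↦ ?_).trans_eq (by rw [hlen, abs_of_nonneg hh0])
    rw [Set.uIoc_of_le (hle k)] at hs
    rw [← dist_eq_norm]
    refine (huc _ (hmem k hk _ ⟨le_rfl, hle k⟩) _ (hmem k hk s ⟨hs.1.le, hs.2⟩) ?_).le
    rw [Real.dist_eq, abs_sub_comm, abs_of_nonneg (by linarith [hs.1])]
    linarith [hs.2]
  refine (norm_sum_le_of_le _ hterm).trans_lt ?_
  rw [Finset.sum_const, Finset.card_range, nsmul_eq_mul, mul_left_comm, hnh, div_mul_eq_mul_div,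
    div_lt_iff₀ (by positivity)]
  nlinarith

/-- Variation of constants for the linear integral equation `G = X - θ ∫ G`. -/
theorem eq_sub_of_integral_equation {T θ : ℝ} {G X : ℝ → ℝ}
    (hG : ContinuousOn G (Set.Icc 0 T))
    (h : ∀ t ∈ Set.Icc 0 T, G t = X t - θ * ∫ s in (0 : ℝ)..t, G s) {t : ℝ}
    (ht : t ∈ Set.Icc 0 T) :
    G t = X t - θ * (Real.exp (-θ * t) * ∫ s in (0 : ℝ)..t, Real.exp (θ * s) * X s) := by
  have hGt : ContinuousOn G (Set.Icc 0 t) := hG.mono (Set.Icc_subset_Icc_right ht.2)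
  have hint : IntervalIntegrable G volume 0 t := by
    apply ContinuousOn.intervalIntegrable
    rwa [Set.uIcc_of_le ht.1]
  have hprim : ContinuousOn (fun s ↦ ∫ u in (0 : ℝ)..s, G u) (Set.Icc 0 t) := by
    have := intervalIntegral.continuousOn_primitive_interval
      (f := G) (μ := volume) (a := 0) (b := t)
      (by rw [Set.uIcc_of_le ht.1]; exact hGt.integrableOn_Icc)
    rwa [Set.uIcc_of_le ht.1] at this
  have hX : ContinuousOn X (Set.Icc 0 t) := by
    refine (hGt.add (hprim.const_mul θ : ContinuousOn (fun s ↦ θ * ∫ u in (0 : ℝ)..s, G u) _)).congr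
      fun s hs ↦ ?_
    simp only [Pi.add_apply, h s ⟨hs.1, hs.2.trans ht.2⟩]
    ring
  -- Integrating factor: the equation says that `e^{θs} ∫₀ˢ G` has derivative `e^{θs} X s`.
  have key := intervalIntegral.integral_eq_sub_of_hasDerivAt_of_le ht.1
    (f := fun s ↦ Real.exp (θ * s) * ∫ u in (0 : ℝ)..s, G u)
    (f' := fun s ↦ Real.exp (θ * s) * X s) ?_ ?_ ?_
  · rw [key, h t ht]
    have : Real.exp (-θ * t) * Real.exp (θ * t) = 1 := by rw [← Real.exp_add]; simp
    simp only [intervalIntegral.integral_same, mul_zero, sub_zero]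
    linear_combination (θ * ∫ u in (0 : ℝ)..t, G u) * this
  · exact ContinuousOn.mul (by fun_prop) hprim
  · intro s hs
    have h1 : HasDerivAt (fun s ↦ ∫ u in (0 : ℝ)..s, G u) (G s) s := by
      refine intervalIntegral.integral_hasDerivAt_right
        (hint.mono_set ?_) ?_ (hGt.continuousAt (Icc_mem_nhds hs.1 hs.2))
      · rw [Set.uIcc_of_le hs.1.le, Set.uIcc_of_le ht.1]
        exact Set.Icc_subset_Icc_right hs.2.le
      · exact (hGt.mono Set.Ioo_subset_Icc_self).stronglyMeasurableAtFilter isOpen_Ioo s hs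
    have h2 : HasDerivAt (fun s ↦ Real.exp (θ * s)) (Real.exp (θ * s) * θ) s := by
      simpa using ((hasDerivAt_id s).const_mul θ).exp
    refine (h2.mul h1).congr_deriv ?_
    rw [h s ⟨hs.1.le, hs.2.le.trans ht.2⟩]
    ring
  · apply ContinuousOn.intervalIntegrable
    rw [Set.uIcc_of_le ht.1]
    exact ContinuousOn.mul (by fun_prop) hX

theorem integral_exp_mul {θ : ℝ} (hθ : θ ≠ 0) (a b : ℝ) :
    ∫ u in a..b, Real.exp (θ * u) = (Real.exp (θ * b) - Real.exp (θ * a)) / θ := by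
  rw [intervalIntegral.integral_comp_mul_left (fun x ↦ Real.exp x) hθ, integral_exp, smul_eq_mul]
  field_simp

theorem integral_exp_mul_min {θ : ℝ} (hθ : θ ≠ 0) {b t : ℝ} (ht : 0 ≤ t) (hb : 0 ≤ b) :
    θ * ∫ u in (0 : ℝ)..b, Real.exp (θ * u) * min u t =
      Real.exp (θ * b) * min b t - (Real.exp (θ * min b t) - 1) / θ := by
  have base : ∀ c, 0 ≤ c → c ≤ t → θ * ∫ u in (0 : ℝ)..c, Real.exp (θ * u) * min u t =
      Real.exp (θ * c) * c - (Real.exp (θ * c) - 1) / θ := by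
    intro c hc hct
    have h1 : ∫ u in (0 : ℝ)..c, Real.exp (θ * u) * min u t =
        ∫ u in (0 : ℝ)..c, Real.exp (θ * u) * u := by
      refine intervalIntegral.integral_congr fun u hu ↦ ?_
      rw [Set.uIcc_of_le hc] at hu
      simp only [min_eq_left (hu.2.trans hct)]
    have h2 := intervalIntegral.integral_eq_sub_of_hasDerivAt (a := 0) (b := c)
      (f := fun u ↦ Real.exp (θ * u) * u / θ - Real.exp (θ * u) / θ ^ 2)
      (f' := fun u ↦ Real.exp (θ * u) * u) (fun u _ ↦ by
        have h2 : HasDerivAt (fun s ↦ Real.exp (θ * s)) (Real.exp (θ * u) * θ) u := by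
          simpa using ((hasDerivAt_id u).const_mul θ).exp
        refine (((h2.mul (hasDerivAt_id u)).div_const θ).sub (h2.div_const (θ ^ 2))).congr_deriv ?_
        simp only [id]
        field_simp
        ring) (Continuous.intervalIntegrable (by fun_prop) _ _)
    rw [h1, h2]
    simp only [mul_zero, Real.exp_zero]
    field_simp
    ring
  rcases le_total b t with hbt | htb
  · rw [base b hb hbt, min_eq_left hbt]
  · rw [min_eq_right htb, ← intervalIntegral.integral_add_adjacent_intervals (b := t)
      (Continuous.intervalIntegrable (by fun_prop) _ _)
      (Continuous.intervalIntegrable (by fun_prop) _ _), mul_add, base t ht le_rfl]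
    have h1 : ∫ u in t..b, Real.exp (θ * u) * min u t = ∫ u in t..b, Real.exp (θ * u) * t := by
      refine intervalIntegral.integral_congr fun u hu ↦ ?_
      rw [Set.uIcc_of_le htb] at hu
      simp only [min_eq_right hu.1]
    rw [h1, intervalIntegral.integral_mul_const, integral_exp_mul hθ]
    field_simp
    ring

/-- A function on `[0,T]` with vanishing primitive vanishes almost everywhere. -/
theorem ae_eq_zero_of_integral_eq_zero {T : ℝ} (hT : 0 ≤ T) {p : ℝ → ℝ}
    (hp : IntegrableOn p (Set.Icc 0 T)) (h : ∀ t ∈ Set.Icc 0 T, ∫ s in (0 : ℝ)..t, p s = 0) :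
    p =ᵐ[volume.restrict (Set.Icc 0 T)] 0 := by
  have hp' : IntervalIntegrable p volume 0 T := by
    rw [intervalIntegrable_iff_integrableOn_Icc_of_le hT]
    exact hp
  -- At interior points the primitive vanishes on a whole neighbourhood, so its derivative, a.e.
  -- equal to `p`, is zero.
  rw [← Measure.restrict_congr_set Ioo_ae_eq_Icc]
  filter_upwards [ae_restrict_of_ae hp'.ae_hasDerivAt_integral, ae_restrict_mem measurableSet_Ioo]
    with x hx hxm
  rw [Set.uIcc_of_le hT] at hx
  have h1 := hx (Set.Ioo_subset_Icc_self hxm) 0 ⟨le_rfl, hT⟩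
  have h2 : (fun x ↦ ∫ s in (0 : ℝ)..x, p s) =ᶠ[𝓝 x] fun _ ↦ 0 := by
    filter_upwards [Icc_mem_nhds hxm.1 hxm.2] with y hy using h y hy
  exact h1.unique ((hasDerivAt_const x (0 : ℝ)).congr_of_eventuallyEq h2)

end RealAnalysis

/-! ### Step functions in `L²([0,T])`: density and bounds on elementary integrals -/

section StepFunctions

variable {E : Type*} [NormedAddCommGroup E] [NormedSpace ℝ E]

namespace StepFunction

variable {T : ℝ}

/-- The elementary integral `∑ i, coeff i • (γ (right i) - γ (left i))` of a step function against
a path `γ` in a vector space. -/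
def increments (f : StepFunction T) (γ : ℝ → E) : E :=
  ∑ i, f.coeff i • (γ (f.right i) - γ (f.left i))

/-- The sum of two step functions. -/
def add (f g : StepFunction T) : StepFunction T where
  n := f.n + g.n
  coeff := Fin.append f.coeff g.coeff
  left := Fin.append f.left g.left
  right := Fin.append f.right g.right
  zero_le_left i := by
    refine Fin.addCases (fun i ↦ ?_) (fun i ↦ ?_) i
    · simpa using f.zero_le_left i
    · simpa using g.zero_le_left i
  left_le_right i := by
    refine Fin.addCases (fun i ↦ ?_) (fun i ↦ ?_) i
    · simpa using f.left_le_right i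
    · simpa using g.left_le_right i
  right_le i := by
    refine Fin.addCases (fun i ↦ ?_) (fun i ↦ ?_) i
    · simpa using f.right_le i
    · simpa using g.right_le i

/-- A scalar multiple of a step function. -/
def smul (c : ℝ) (f : StepFunction T) : StepFunction T :=
  { f with coeff := fun i ↦ c * f.coeff i }

/-- The step function `1_{(0,t]}`. -/
def single (t : ℝ) (ht : t ∈ Set.Icc 0 T) : StepFunction T where
  n := 1
  coeff _ := 1
  left _ := 0
  right _ := t
  zero_le_left _ := le_rfl
  left_le_right _ := ht.1
  right_le _ := ht.2

/-- The step function without any steps. -/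
def zero : StepFunction T where
  n := 0
  coeff _ := 0
  left _ := 0
  right _ := 0
  zero_le_left _ := le_rfl
  left_le_right _ := le_rfl
  right_le i := i.elim0

theorem right_mem (f : StepFunction T) (i : Fin f.n) : f.right i ∈ Set.Icc 0 T :=
  ⟨(f.zero_le_left i).trans (f.left_le_right i), f.right_le i⟩

theorem left_mem (f : StepFunction T) (i : Fin f.n) : f.left i ∈ Set.Icc 0 T :=
  ⟨f.zero_le_left i, (f.left_le_right i).trans (f.right_le i)⟩

theorem increments_add (f g : StepFunction T) (γ : ℝ → E) :
    (f.add g).increments γ = f.increments γ + g.increments γ := by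
  simp only [increments]
  refine (Fin.sum_univ_add (a := f.n) (b := g.n) _).trans ?_
  simp [add]

theorem increments_smul (c : ℝ) (f : StepFunction T) (γ : ℝ → E) :
    (f.smul c).increments γ = c • f.increments γ := by
  simp only [increments, smul, Finset.smul_sum, mul_smul]
  rfl

theorem increments_single {t : ℝ} (ht : t ∈ Set.Icc 0 T) (γ : ℝ → E) :
    (single t ht).increments γ = γ t - γ 0 :=
  (Fin.sum_univ_one _).trans (one_smul ℝ _)

theorem increments_zero (γ : ℝ → E) : (zero : StepFunction T).increments γ = 0 := by
  exact Fin.sum_univ_zero _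

theorem increments_sub_smul (f : StepFunction T) (c : ℝ) (γ γ' : ℝ → E) :
    f.increments (fun t ↦ γ t - c • γ' t) = f.increments γ - c • f.increments γ' := by
  simp only [increments, Finset.smul_sum, ← Finset.sum_sub_distrib]
  refine Finset.sum_congr rfl fun i _ ↦ ?_
  module

theorem increments_congr (f : StepFunction T) {γ γ' : ℝ → E}
    (h : ∀ t ∈ Set.Icc 0 T, γ t = γ' t) : f.increments γ = f.increments γ' := by
  simp only [increments]
  exact Finset.sum_congr rfl fun i _ ↦ by rw [h _ (f.right_mem i), h _ (f.left_mem i)]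

theorem map_increments {F : Type*} [NormedAddCommGroup F] [NormedSpace ℝ F] (f : StepFunction T)
    (A : E →ₗ[ℝ] F) (γ : ℝ → E) : A (f.increments γ) = f.increments fun t ↦ A (γ t) := by
  simp [increments]

theorem increments_const_add (f : StepFunction T) (c : ℝ) (x : E) (γ : ℝ → E) :
    f.increments (fun t ↦ x + c • γ t) = c • f.increments γ := by
  simp only [increments, Finset.smul_sum]
  refine Finset.sum_congr rfl fun i _ ↦ ?_
  module

/-- Paths in inner product spaces with the same covariance have isometric elementary integrals. -/
theorem norm_increments_eq {H K : Type*} [NormedAddCommGroup H] [InnerProductSpace ℝ H]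
    [NormedAddCommGroup K] [InnerProductSpace ℝ K] {u : ℝ → H} {v : ℝ → K}
    (h : ∀ s ∈ Set.Icc 0 T, ∀ t ∈ Set.Icc 0 T, inner ℝ (u s) (u t) = inner ℝ (v s) (v t))
    (f : StepFunction T) : ‖f.increments u‖ = ‖f.increments v‖ := by
  rw [← sq_eq_sq₀ (norm_nonneg _) (norm_nonneg _), ← real_inner_self_eq_norm_sq,
    ← real_inner_self_eq_norm_sq]
  simp only [increments, sum_inner, inner_sum, inner_smul_left, inner_smul_right,
    Finset.mul_sum]
  refine Finset.sum_congr rfl fun i _ ↦ Finset.sum_congr rfl fun j _ ↦ ?_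
  simp only [inner_sub_left, inner_sub_right]
  rw [h _ (f.right_mem _) _ (f.right_mem _), h _ (f.right_mem _) _ (f.left_mem _),
    h _ (f.left_mem _) _ (f.right_mem _), h _ (f.left_mem _) _ (f.left_mem _)]

end StepFunction

/-- The space `L²([0,T])`. -/
abbrev L2Icc (T : ℝ) := Lp ℝ 2 (volume.restrict (Set.Icc 0 T))

/-- The class of the indicator function `1_{(-∞,t]}` in `L²([0,T])`. -/
def indPath (T t : ℝ) : L2Icc T :=
  indicatorConstLp 2 (measurableSet_Iic (a := t)) (measure_ne_top _ _) (1 : ℝ)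

variable {T : ℝ}

theorem Iic_inter_Icc {t : ℝ} (ht : t ∈ Set.Icc 0 T) :
    Set.Iic t ∩ Set.Icc 0 T = Set.Icc 0 t := by
  ext x
  simp only [Set.mem_inter_iff, Set.mem_Iic, Set.mem_Icc]
  exact ⟨fun h ↦ ⟨h.2.1, h.1⟩, fun h ↦ ⟨h.2, h.1, h.2.trans ht.2⟩⟩

theorem setIntegral_Iic_restrict {t : ℝ} (ht : t ∈ Set.Icc 0 T) (φ : ℝ → E) :
    ∫ s in Set.Iic t, φ s ∂(volume.restrict (Set.Icc 0 T)) = ∫ s in (0 : ℝ)..t, φ s := by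
  rw [Measure.restrict_restrict measurableSet_Iic, Iic_inter_Icc ht,
    integral_Icc_eq_integral_Ioc, intervalIntegral.integral_of_le ht.1]

theorem inner_indPath {t : ℝ} (ht : t ∈ Set.Icc 0 T) (φ : L2Icc T) :
    inner ℝ (indPath T t) φ = ∫ s in (0 : ℝ)..t, φ s := by
  rw [indPath, L2.inner_indicatorConstLp_one, setIntegral_Iic_restrict ht]

theorem inner_indPath_toLp {t : ℝ} (ht : t ∈ Set.Icc 0 T) {φ : ℝ → ℝ}
    (hφ : MemLp φ 2 (volume.restrict (Set.Icc 0 T))) :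
    inner ℝ (indPath T t) (hφ.toLp φ) = ∫ s in (0 : ℝ)..t, φ s := by
  rw [indPath, L2.inner_indicatorConstLp_one, ← setIntegral_Iic_restrict ht]
  exact integral_congr_ae (ae_restrict_of_ae hφ.coeFn_toLp)

theorem inner_indPath_indPath {s t : ℝ} (hs : s ∈ Set.Icc 0 T) (ht : t ∈ Set.Icc 0 T) :
    inner ℝ (indPath T s) (indPath T t) = min s t := by
  have hst : min s t ∈ Set.Icc 0 T := ⟨le_min hs.1 ht.1, (min_le_left _ _).trans hs.2⟩
  rw [indPath, indPath, L2.inner_indicatorConstLp_one_indicatorConstLp_one, Set.Iic_inter_Iic,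
    measureReal_restrict_apply measurableSet_Iic]
  change volume.real (Set.Iic (min s t) ∩ Set.Icc 0 T) = _
  rw [Iic_inter_Icc hst, Real.volume_real_Icc_of_le hst.1, sub_zero]

theorem StepFunction.toFun_ae_eq (f : StepFunction T) :
    f.toFun =ᵐ[volume.restrict (Set.Icc 0 T)] ⇑(f.increments (indPath T)) := by
  have h1 : ∀ t, indPath T t =ᵐ[volume.restrict (Set.Icc 0 T)]
      (Set.Iic t).indicator fun _ ↦ (1 : ℝ) := fun t ↦ indicatorConstLp_coeFn
  have h2 : ∀ i, ⇑(f.coeff i • (indPath T (f.right i) - indPath T (f.left i)))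
      =ᵐ[volume.restrict (Set.Icc 0 T)]
      fun x ↦ f.coeff i * (Set.Ioc (f.left i) (f.right i)).indicator (fun _ ↦ (1 : ℝ)) x := by
    intro i
    filter_upwards [Lp.coeFn_smul (f.coeff i) (indPath T (f.right i) - indPath T (f.left i)),
      Lp.coeFn_sub (indPath T (f.right i)) (indPath T (f.left i)), h1 (f.right i), h1 (f.left i)]
      with x e1 e2 e3 e4
    rw [e1, Pi.smul_apply, e2, Pi.sub_apply, e3, e4, smul_eq_mul]
    congr 1
    have := f.left_le_right i
    simp only [Set.indicator_apply, Set.mem_Iic, Set.mem_Ioc]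
    split_ifs <;> grind
  rw [StepFunction.increments]
  filter_upwards [Lp.coeFn_finsetSum Finset.univ
    fun i ↦ f.coeff i • (indPath T (f.right i) - indPath T (f.left i)), ae_all_iff.2 h2]
    with x e1 e2
  rw [e1, StepFunction.toFun]
  simp only [Finset.sum_apply, e2]

theorem StepFunction.memLp_toFun (f : StepFunction T) :
    MemLp f.toFun 2 (volume.restrict (Set.Icc 0 T)) :=
  (Lp.memLp _).ae_eq f.toFun_ae_eq.symm

theorem StepFunction.toLp_toFun (f : StepFunction T) :
    f.memLp_toFun.toLp f.toFun = f.increments (indPath T) := by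
  refine Lp.ext ?_
  exact f.memLp_toFun.coeFn_toLp.trans f.toFun_ae_eq

/-- The subspace of classes of step functions in `L²([0,T])`. -/
def stepSubmodule (T : ℝ) : Submodule ℝ (L2Icc T) where
  carrier := Set.range fun f : StepFunction T ↦ f.increments (indPath T)
  add_mem' := by
    rintro _ _ ⟨f, rfl⟩ ⟨g, rfl⟩
    exact ⟨f.add g, f.increments_add g _⟩
  zero_mem' := ⟨StepFunction.zero, StepFunction.increments_zero _⟩
  smul_mem' := by
    rintro c _ ⟨f, rfl⟩
    exact ⟨f.smul c, f.increments_smul c _⟩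

theorem L2Icc_eq_zero (hT : 0 ≤ T) {φ : L2Icc T}
    (h : ∀ t ∈ Set.Icc 0 T, inner ℝ (indPath T t) φ = 0) : φ = 0 := by
  rw [Lp.eq_zero_iff_ae_eq_zero]
  refine ae_eq_zero_of_integral_eq_zero hT ((Lp.memLp φ).integrable (by norm_num)) fun t ht ↦ ?_
  rw [← inner_indPath ht, h t ht]

/-- Step functions are dense in `L²([0,T])`. -/
theorem topologicalClosure_stepSubmodule (hT : 0 ≤ T) :
    (stepSubmodule T).topologicalClosure = ⊤ := by
  rw [Submodule.topologicalClosure_eq_top_iff, Submodule.eq_bot_iff]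
  intro φ hφ
  rw [Submodule.mem_orthogonal] at hφ
  refine L2Icc_eq_zero hT fun t ht ↦ ?_
  -- Within `[0,T]` the half-line `(-∞,0]` leaves only the null set `{0}`, so `1_{(0,t]}` and
  -- `1_{(-∞,t]}` have the same class.
  have h0 : indPath T 0 = 0 := by
    rw [← inner_self_eq_zero (𝕜 := ℝ), inner_indPath_indPath ⟨le_rfl, hT⟩ ⟨le_rfl, hT⟩, min_self]
  refine hφ _ ⟨StepFunction.single t ht, ?_⟩
  simp only [StepFunction.increments_single, h0, sub_zero]

theorem exists_seq_increments_tendsto (hT : 0 ≤ T) (φ : L2Icc T) :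
    ∃ f : ℕ → StepFunction T, Tendsto (fun n ↦ (f n).increments (indPath T)) atTop (𝓝 φ) := by
  have hφ : φ ∈ closure (stepSubmodule T : Set (L2Icc T)) := by
    rw [← Submodule.topologicalClosure_coe, topologicalClosure_stepSubmodule hT]
    trivial
  obtain ⟨x, hx, hlim⟩ := mem_closure_iff_seq_limit.1 hφ
  choose f hf using hx
  exact ⟨f, by simpa only [hf] using hlim⟩

/-- The elementary integral against a `C¹` path is bounded in `L²([0,T])`. -/
theorem exists_norm_increments_le_of_hasDerivAt [CompleteSpace E] {u v : ℝ → E}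
    (hu : ∀ t, HasDerivAt u (v t) t) (hv : Continuous v) :
    ∃ C : ℝ, ∀ f : StepFunction T, ‖f.increments u‖ ≤ C * ‖f.increments (indPath T)‖ := by
  obtain ⟨M, hM⟩ := (isCompact_Icc (a := (0 : ℝ)) (b := T)).exists_bound_of_continuousOn
    hv.continuousOn
  have hvM : ∀ᵐ x ∂(volume.restrict (Set.Icc 0 T)), ‖v x‖ ≤ M :=
    (ae_restrict_mem measurableSet_Icc).mono hM
  have hφ : ∀ φ : L2Icc T, Integrable φ (volume.restrict (Set.Icc 0 T)) :=
    fun φ ↦ (Lp.memLp φ).integrable (by norm_num)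
  have hφv : ∀ φ : L2Icc T, Integrable (fun s ↦ φ s • v s) (volume.restrict (Set.Icc 0 T)) :=
    fun φ ↦ (hφ φ).smul_bdd M hv.aestronglyMeasurable hvM
  -- For a `C¹` path, `∫ f du = ∫ f(s) u'(s) ds`; the right side makes sense for every `φ` in `L²`
  -- and is bounded because `v` is bounded on `[0,T]`.
  let A : L2Icc T →ₗ[ℝ] E :=
    { toFun := fun φ ↦ ∫ s in Set.Icc 0 T, φ s • v s
      map_add' := fun φ ψ ↦ by
        rw [← integral_add (hφv φ) (hφv ψ)]
        refine integral_congr_ae ?_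
        filter_upwards [Lp.coeFn_add φ ψ] with s hs
        rw [hs, Pi.add_apply, add_smul]
      map_smul' := fun c φ ↦ by
        rw [RingHom.id_apply, ← integral_smul]
        refine integral_congr_ae ?_
        filter_upwards [Lp.coeFn_smul c φ] with s hs
        rw [hs, Pi.smul_apply, smul_eq_mul, mul_smul] }
  have hA : ∀ t ∈ Set.Icc 0 T, A (indPath T t) = u t - u 0 := by
    intro t ht
    have h1 : A (indPath T t) =
        ∫ s in Set.Iic t, v s ∂(volume.restrict (Set.Icc 0 T)) := by
      rw [← integral_indicator measurableSet_Iic]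
      refine integral_congr_ae ?_
      have h2 : indPath T t =ᵐ[volume.restrict (Set.Icc 0 T)]
        (Set.Iic t).indicator fun _ ↦ (1 : ℝ) := indicatorConstLp_coeFn
      filter_upwards [h2] with s hs
      rw [hs]
      by_cases hst : s ∈ Set.Iic t <;> simp [hst]
    rw [h1, setIntegral_Iic_restrict ht]
    exact intervalIntegral.integral_eq_sub_of_hasDerivAt (fun s _ ↦ hu s)
      (hv.intervalIntegrable _ _)
  -- The Hölder constant of the inclusion of `L²([0,T])` in `L¹([0,T])`.
  set D := (volume.restrict (Set.Icc 0 T) Set.univ ^ (1 / (1 : ℝ≥0∞).toReal - 1 / (2 : ℝ≥0∞).toReal))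
    with hD
  have hD' : D ≠ ∞ := by
    rw [hD]
    refine ENNReal.rpow_ne_top_of_nonneg (by norm_num) (measure_ne_top _ _)
  have hbound : ∀ φ : L2Icc T, ‖A φ‖ ≤ D.toReal * |M| * ‖φ‖ := by
    intro φ
    have h1 : ‖A φ‖ ≤ ∫ s in Set.Icc 0 T, ‖φ s‖ * |M| := by
      refine norm_integral_le_of_norm_le ((hφ φ).norm.mul_const _) ?_
      filter_upwards [hvM] with s hs
      rw [norm_smul]
      gcongr
      exact hs.trans (le_abs_self M)
    have h2 : ∫ s in Set.Icc 0 T, ‖φ s‖ ≤ ‖φ‖ * D.toReal := by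
      rw [integral_norm_eq_lintegral_enorm (hφ φ).1, ← eLpNorm_one_eq_lintegral_enorm,
        Lp.norm_def, ← ENNReal.toReal_mul]
      exact ENNReal.toReal_mono (ENNReal.mul_ne_top (Lp.eLpNorm_ne_top φ) hD')
        (eLpNorm_le_eLpNorm_mul_rpow_measure_univ (by norm_num) (hφ φ).1)
    rw [integral_mul_const] at h1
    nlinarith [abs_nonneg M]
  refine ⟨D.toReal * |M|, fun f ↦ ?_⟩
  refine le_trans (le_of_eq ?_) (hbound (f.increments (indPath T)))
  rw [f.map_increments, f.increments_congr hA]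
  simp [StepFunction.increments]

end StepFunctions

/-! ### The Ornstein-Uhlenbeck path in a Hilbert space and its covariance with `W` -/

section Hilbert

variable {T : ℝ} {H : Type*} [NormedAddCommGroup H] [InnerProductSpace ℝ H] [CompleteSpace H]

/-- The solution `γ` of `γ = x - θ ∫ γ`, by variation of constants. -/
def ouPath (θ : ℝ) (x : ℝ → H) (t : ℝ) : H :=
  x t - θ • (Real.exp (-θ * t) • ∫ s in (0 : ℝ)..t, Real.exp (θ * s) • x s)

/-- The path splits into `σ w`, whose elementary integrals are isometric up to the factor `|σ|`, and
a `C¹` drift; the constant `x₀` in `x` drops out of the increments. -/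
theorem exists_norm_increments_ouPath_le {w : ℝ → H} (hw : Continuous w)
    (hcov : ∀ s ∈ Set.Icc 0 T, ∀ t ∈ Set.Icc 0 T, inner ℝ (w s) (w t) = min s t)
    (θ σ : ℝ) (x₀ : H) :
    ∃ C : ℝ, ∀ f : StepFunction T,
      ‖f.increments (ouPath θ fun t ↦ x₀ + σ • w t)‖ ≤ C * ‖f.increments (indPath T)‖ := by
  set x : ℝ → H := fun t ↦ x₀ + σ • w t with hx
  have hxc : Continuous x := by fun_prop
  set y : ℝ → H := fun t ↦ Real.exp (-θ * t) • ∫ s in (0 : ℝ)..t, Real.exp (θ * s) • x s with hy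
  have hcont : Continuous fun s ↦ Real.exp (θ * s) • x s := by fun_prop
  -- The drift solves `y' = x - θ y` with a continuous right-hand side, hence is `C¹`.
  have hyd : ∀ t, HasDerivAt y (x t - θ • y t) t := by
    intro t
    have h1 : HasDerivAt (fun t ↦ ∫ s in (0 : ℝ)..t, Real.exp (θ * s) • x s)
        (Real.exp (θ * t) • x t) t :=
      intervalIntegral.integral_hasDerivAt_right (hcont.intervalIntegrable _ _)
        (hcont.stronglyMeasurableAtFilter _ _) hcont.continuousAt
    have h2 : HasDerivAt (fun t ↦ Real.exp (-θ * t)) (Real.exp (-θ * t) * -θ) t := by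
      simpa using ((hasDerivAt_id t).const_mul (-θ)).exp
    refine (h2.smul h1).congr_deriv ?_
    rw [smul_smul, ← Real.exp_add, hy]
    simp only [neg_mul, neg_add_cancel, Real.exp_zero, one_smul, mul_neg, neg_smul]
    module
  have hyc : Continuous y := continuous_iff_continuousAt.2 fun t ↦ (hyd t).continuousAt
  obtain ⟨C, hC⟩ := exists_norm_increments_le_of_hasDerivAt (T := T) hyd (by fun_prop)
  refine ⟨|σ| + |θ| * C, fun f ↦ ?_⟩
  have h1 : f.increments (ouPath θ x) = σ • f.increments w - θ • f.increments y := by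
    rw [← f.increments_const_add σ x₀ w]
    exact f.increments_sub_smul θ x y
  have h2 : ‖f.increments w‖ = ‖f.increments (indPath T)‖ :=
    StepFunction.norm_increments_eq
      (fun s hs t ht ↦ by rw [hcov s hs t ht, inner_indPath_indPath hs ht]) f
  rw [h1]
  refine (norm_sub_le _ _).trans ?_
  rw [norm_smul, norm_smul, h2, Real.norm_eq_abs, Real.norm_eq_abs, add_mul, mul_assoc]
  gcongr
  exact hC f

/-- The inner product passes under the Bochner integral, and orthogonality removes `x₀`, so the
initial law has no influence; `integral_exp_mul_min` does the rest. -/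
theorem inner_ouPath {w : ℝ → H} (hw : Continuous w)
    (hcov : ∀ s ∈ Set.Icc 0 T, ∀ t ∈ Set.Icc 0 T, inner ℝ (w s) (w t) = min s t)
    {θ : ℝ} (hθ : θ ≠ 0) (σ : ℝ) {x₀ : H} (h₀ : ∀ t ∈ Set.Icc 0 T, inner ℝ x₀ (w t) = 0)
    {b t : ℝ} (hb : b ∈ Set.Icc 0 T) (ht : t ∈ Set.Icc 0 T) :
    inner ℝ (ouPath θ (fun t ↦ x₀ + σ • w t) b) (w t) =
      σ / θ * (Real.exp (-θ * b) * (Real.exp (θ * min b t) - 1)) := by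
  have h1 : ∀ s ∈ Set.Icc 0 T, inner ℝ (x₀ + σ • w s) (w t) = σ * min s t := by
    intro s hs
    rw [inner_add_left, h₀ t ht, inner_smul_left, hcov s hs t ht]
    simp
  have h2 : inner ℝ (∫ s in (0 : ℝ)..b, Real.exp (θ * s) • (x₀ + σ • w s)) (w t) =
      σ * ∫ s in (0 : ℝ)..b, Real.exp (θ * s) * min s t := by
    rw [real_inner_comm, intervalIntegral.integral_of_le hb.1, ← integral_inner,
      ← intervalIntegral.integral_of_le hb.1, ← intervalIntegral.integral_const_mul]
    · refine intervalIntegral.integral_congr fun s hs ↦ ?_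
      rw [Set.uIcc_of_le hb.1] at hs
      rw [inner_smul_right, real_inner_comm, h1 s ⟨hs.1, hs.2.trans hb.2⟩]
      ring
    · exact (Continuous.intervalIntegrable (by fun_prop) 0 b).1
  have h3 := integral_exp_mul_min hθ ht.1 hb.1
  have h4 : Real.exp (-(θ * b)) * Real.exp (θ * b) = 1 := by rw [← Real.exp_add]; simp
  rw [ouPath, inner_sub_left, h1 b hb, inner_smul_left, inner_smul_left, h2]
  simp only [conj_trivial]
  have h5 : θ * (Real.exp (-θ * b) * (σ * ∫ s in (0 : ℝ)..b, Real.exp (θ * s) * min s t)) =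
      σ * (Real.exp (-θ * b) * (Real.exp (θ * b) * min b t - (Real.exp (θ * min b t) - 1) / θ)) := by
    rw [← h3]; ring
  rw [h5]
  field_simp
  linear_combination (-θ * σ * min b t) * h4

/-- The density of the covariance of an Ornstein-Uhlenbeck process with `W t`. -/
def covDensity (θ σ t s : ℝ) : ℝ :=
  σ * (Real.exp (-θ * s) *
    (Real.exp (θ * t) * (Set.Iic t).indicator (fun _ ↦ 1) s - (Real.exp (θ * t) - 1)))

theorem measurable_covDensity (θ σ t : ℝ) : Measurable (covDensity θ σ t) := by
  have : Measurable ((Set.Iic t).indicator fun _ : ℝ ↦ (1 : ℝ)) :=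
    measurable_const.indicator measurableSet_Iic
  unfold covDensity
  fun_prop

theorem memLp_covDensity (θ σ t : ℝ) (T : ℝ) :
    MemLp (covDensity θ σ t) 2 (volume.restrict (Set.Icc 0 T)) := by
  obtain ⟨M, hM⟩ := (isCompact_Icc (a := (0 : ℝ)) (b := T)).exists_bound_of_continuousOn
    (f := fun s ↦ Real.exp (-θ * s)) (by fun_prop)
  refine MemLp.of_bound (measurable_covDensity θ σ t).aestronglyMeasurable
    (|σ| * (M * (Real.exp (θ * t) + |Real.exp (θ * t) - 1|))) ?_
  filter_upwards [ae_restrict_mem measurableSet_Icc] with s hs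
  rw [covDensity, norm_mul, norm_mul, Real.norm_eq_abs]
  have hM0 := (norm_nonneg _).trans (hM s hs)
  gcongr
  · exact hM s hs
  · refine (norm_sub_le _ _).trans ?_
    rw [Real.norm_eq_abs, Real.norm_eq_abs]
    gcongr
    by_cases h : s ∈ Set.Iic t <;> simp [h, Real.exp_nonneg]

theorem integral_mul_covDensity {p : ℝ → ℝ} (θ σ : ℝ) {b t : ℝ} (hb : 0 ≤ b) (ht : 0 ≤ t)
    (hp : IntervalIntegrable (fun s ↦ Real.exp (-θ * s) * p s) volume 0 b) :
    ∫ s in (0 : ℝ)..b, p s * covDensity θ σ t s =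
      σ * (Real.exp (θ * t) * (∫ s in (0 : ℝ)..(min b t), Real.exp (-θ * s) * p s) -
        (Real.exp (θ * t) - 1) * ∫ s in (0 : ℝ)..b, Real.exp (-θ * s) * p s) := by
  set q : ℝ → ℝ := fun s ↦ Real.exp (-θ * s) * p s with hq
  have hind : IntervalIntegrable ((Set.Iic t).indicator q) volume 0 b :=
    ⟨hp.1.indicator measurableSet_Iic, hp.2.indicator measurableSet_Iic⟩
  have h1 : ∫ s in (0 : ℝ)..(min b t), q s = ∫ s in (0 : ℝ)..b, (Set.Iic t).indicator q s := by
    rw [intervalIntegral.integral_of_le hb, intervalIntegral.integral_of_le (le_min hb ht),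
      integral_indicator measurableSet_Iic, Measure.restrict_restrict measurableSet_Iic,
      Set.inter_comm, Set.Ioc_inter_Iic]
  have h2 : ∀ s, p s * covDensity θ σ t s =
      σ * (Real.exp (θ * t) * (Set.Iic t).indicator q s - (Real.exp (θ * t) - 1) * q s) := by
    intro s
    rw [covDensity, hq]
    by_cases h : s ∈ Set.Iic t
    · simp only [h, Set.indicator_of_mem]; ring
    · simp only [h, not_false_eq_true, Set.indicator_of_notMem]; ring
  simp only [h2]
  rw [intervalIntegral.integral_const_mul, intervalIntegral.integral_sub
    (hind.const_mul _) (hp.const_mul _), intervalIntegral.integral_const_mul,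
    intervalIntegral.integral_const_mul, h1]

/-- The right-hand side is that of `inner_ouPath`: this is what makes `covDensity` the density of
the covariance. -/
theorem inner_indPath_covDensity {θ : ℝ} (hθ : θ ≠ 0) (σ : ℝ) {b t : ℝ} (hb : b ∈ Set.Icc 0 T)
    (ht : 0 ≤ t) :
    inner ℝ (indPath T b) ((memLp_covDensity θ σ t T).toLp _) =
      σ / θ * (Real.exp (-θ * b) * (Real.exp (θ * min b t) - 1)) := by
  have h1 := integral_mul_covDensity (p := fun _ ↦ 1) θ σ hb.1 ht
    (Continuous.intervalIntegrable (by fun_prop) _ _)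
  simp only [one_mul, mul_one, integral_exp_mul (neg_ne_zero.2 hθ)] at h1
  rw [inner_indPath_toLp hb, h1]
  simp only [mul_zero, Real.exp_zero]
  rcases le_total b t with h | h
  · have h4 : Real.exp (-(θ * b)) * Real.exp (θ * b) = 1 := by rw [← Real.exp_add]; simp
    rw [min_eq_left h]
    field_simp
    linear_combination -σ * h4
  · have h4 : Real.exp (-(θ * t)) * Real.exp (θ * t) = 1 := by rw [← Real.exp_add]; simp
    rw [min_eq_right h]
    field_simp
    linear_combination -σ * h4

/-- Functions orthogonal to all covariance densities vanish. -/
theorem L2Icc_eq_zero_of_inner_covDensity (hT : 0 ≤ T) {θ σ : ℝ} (hσ : σ ≠ 0) {φ : L2Icc T}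
    (h : ∀ t ∈ Set.Icc 0 T, inner ℝ φ ((memLp_covDensity θ σ t T).toLp _) = 0) : φ = 0 := by
  have hφ : IntegrableOn φ (Set.Icc 0 T) := (Lp.memLp φ).integrable (by norm_num)
  have hp : IntegrableOn (fun s ↦ Real.exp (-θ * s) * φ s) (Set.Icc 0 T) :=
    hφ.continuousOn_mul (by fun_prop) isCompact_Icc
  have hp' : IntervalIntegrable (fun s ↦ Real.exp (-θ * s) * φ s) volume 0 T :=
    (intervalIntegrable_iff_integrableOn_Icc_of_le hT).2 hp
  set F : ℝ → ℝ := fun t ↦ ∫ s in (0 : ℝ)..t, Real.exp (-θ * s) * φ s with hF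
  have key : ∀ t ∈ Set.Icc 0 T,
      Real.exp (θ * t) * F t - (Real.exp (θ * t) - 1) * F T = 0 := by
    intro t ht
    have h1 : inner ℝ φ ((memLp_covDensity θ σ t T).toLp _) =
        ∫ s in (0 : ℝ)..T, φ s * covDensity θ σ t s := by
      rw [L2.inner_def, intervalIntegral.integral_of_le hT, ← integral_Icc_eq_integral_Ioc]
      refine integral_congr_ae ?_
      filter_upwards [(memLp_covDensity θ σ t T).coeFn_toLp] with s hs
      rw [hs]
      simp [mul_comm]
    rw [h t ht, integral_mul_covDensity θ σ hT ht.1 hp', min_eq_right ht.2] at h1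
    exact (mul_eq_zero.1 h1.symm).resolve_left hσ
  -- At `t = T` the two exponentials cancel and leave `F T` alone.
  have hFT : F T = 0 := by linear_combination key T ⟨hT, le_rfl⟩
  have hF0 : ∀ t ∈ Set.Icc 0 T, F t = 0 := by
    intro t ht
    have := key t ht
    rw [hFT, mul_zero, sub_zero] at this
    exact (mul_eq_zero.1 this).resolve_left (Real.exp_ne_zero _)
  rw [Lp.eq_zero_iff_ae_eq_zero]
  filter_upwards [ae_eq_zero_of_integral_eq_zero hT hp hF0] with s hs
  exact (mul_eq_zero.1 hs).resolve_left (Real.exp_ne_zero _)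

end Hilbert

/-! ### From random processes to paths in `L²(P)` -/

section Probability

variable {Ω : Type*} [MeasurableSpace Ω] {P : Measure Ω}

/-- The Bochner integral in `L²(P)` of a path agrees almost surely with the pathwise integral. -/
theorem integral_ae_eq_integral_Lp {X : ℝ → Ω → ℝ} {x : ℝ → Lp ℝ 2 P} {t : ℝ} (ht : 0 ≤ t)
    (hx : ContinuousOn x (Set.Icc 0 t)) (hX : ∀ s ∈ Set.Icc 0 t, X s =ᵐ[P] x s)
    (hXc : ∀ᵐ ω ∂P, ContinuousOn (fun s ↦ X s ω) (Set.Icc 0 t)) :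
    (fun ω ↦ ∫ s in (0 : ℝ)..t, X s ω) =ᵐ[P] ⇑(∫ s in (0 : ℝ)..t, x s) := by
  -- The same Riemann sums converge in `L²(P)`, hence almost surely along a subsequence, and
  -- pathwise; the two limits must agree.
  obtain ⟨ns, hns, hlim⟩ :=
    (tendstoInMeasure_of_tendsto_Lp (tendsto_riemannSum ht hx)).exists_seq_tendsto_ae
  have hmem : ∀ n : ℕ, ∀ k ∈ Finset.range n, (k : ℝ) * (t / n) ∈ Set.Icc 0 t := by
    intro n k hk
    rw [Finset.mem_range] at hk
    have hn : (0 : ℝ) < n := by exact_mod_cast (by omega : 0 < n)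
    have hkn : (k : ℝ) ≤ n := by exact_mod_cast hk.le
    refine ⟨by positivity, ?_⟩
    rw [mul_div_assoc', div_le_iff₀ hn]
    nlinarith
  have hsum : ∀ n : ℕ, ∀ᵐ ω ∂P,
      (∑ k ∈ Finset.range n, (t / n) • x (k * (t / n)) : Lp ℝ 2 P) ω =
        ∑ k ∈ Finset.range n, (t / n) • X (k * (t / n)) ω := by
    intro n
    have h1 : ∀ k : ℕ, ∀ᵐ ω ∂P, k ∈ Finset.range n →
        ((t / n) • x (k * (t / n)) : Lp ℝ 2 P) ω = (t / n) • X (k * (t / n)) ω := by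
      intro k
      by_cases hk : k ∈ Finset.range n
      · filter_upwards [Lp.coeFn_smul (t / n) (x (k * (t / n))), hX _ (hmem n k hk)]
          with ω e1 e2 _
        rw [e1, Pi.smul_apply, e2]
      · exact Eventually.of_forall fun _ h ↦ absurd h hk
    filter_upwards [Lp.coeFn_finsetSum (Finset.range n) fun k : ℕ ↦ (t / n) • x (k * (t / n)),
      ae_all_iff.2 h1] with ω e1 e2
    rw [e1, Finset.sum_apply]
    exact Finset.sum_congr rfl fun k hk ↦ e2 k hk
  filter_upwards [hlim, ae_all_iff.2 hsum, hXc] with ω h1 h2 h3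
  refine tendsto_nhds_unique ((tendsto_riemannSum ht h3).comp hns.tendsto_atTop) ?_
  simpa only [h2, Function.comp_def] using h1

end Probability

variable {Ω : Type*} [MeasurableSpace Ω] {P : Measure Ω} {T : ℝ}

theorem inner_toLp_toLp {X Y : Ω → ℝ} (hX : MemLp X 2 P) (hY : MemLp Y 2 P) :
    inner ℝ (hX.toLp X) (hY.toLp Y) = ∫ ω, X ω * Y ω ∂P := by
  rw [L2.inner_def]
  refine integral_congr_ae ?_
  filter_upwards [hX.coeFn_toLp, hY.coeFn_toLp] with ω e1 e2
  rw [e1, e2]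
  simp [mul_comm]

theorem IsBrownianMotionOn.memLp {W : ℝ → Ω → ℝ} (hW : IsBrownianMotionOn T W P) {t : ℝ}
    (ht : t ∈ Set.Icc 0 T) : MemLp (W t) 2 P :=
  (hW.isGaussianProcess.hasGaussianLaw_eval ⟨t, ht⟩).memLp_two

theorem IsBrownianMotionOn.inner_toLp [IsProbabilityMeasure P] {W : ℝ → Ω → ℝ}
    (hW : IsBrownianMotionOn T W P) {s t : ℝ} (hs : s ∈ Set.Icc 0 T) (ht : t ∈ Set.Icc 0 T) :
    inner ℝ ((hW.memLp hs).toLp _) ((hW.memLp ht).toLp _) = min s t := by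
  rw [inner_toLp_toLp, ← hW.covariance s hs t ht, covariance_eq_sub (hW.memLp hs) (hW.memLp ht),
    hW.mean_zero s hs, zero_mul, sub_zero]
  rfl

/-- Paths in an inner product space with covariance `min s t` are continuous. -/
theorem continuous_of_inner_eq_min {H : Type*} [NormedAddCommGroup H] [InnerProductSpace ℝ H]
    {w : ℝ → H} {r : ℝ → ℝ} (hr : Continuous r)
    (hw : ∀ s t, inner ℝ (w s) (w t) = min (r s) (r t)) : Continuous w := by
  rw [continuous_iff_continuousAt]
  intro t
  rw [ContinuousAt, tendsto_iff_norm_sub_tendsto_zero]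
  -- Expanding the square gives `r s + r t - 2 min (r s) (r t) = |r s - r t|`.
  have h1 : ∀ s, ‖w s - w t‖ = Real.sqrt |r s - r t| := by
    intro s
    rw [eq_comm, Real.sqrt_eq_iff_mul_self_eq (abs_nonneg _) (norm_nonneg _),
      ← real_inner_self_eq_norm_mul_norm, inner_sub_left, inner_sub_right, inner_sub_right,
      hw, hw, hw, hw, min_self, min_self, min_comm (r t)]
    rcases le_total (r s) (r t) with h | h
    · rw [min_eq_left h, abs_of_nonpos (by linarith)]; ring
    · rw [min_eq_right h, abs_of_nonneg (by linarith)]; ring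
  simp only [h1]
  have h2 : Continuous fun s ↦ Real.sqrt |r s - r t| := by fun_prop
  simpa using h2.tendsto t

/-- An Ornstein-Uhlenbeck process is given in `L²(P)` by variation of constants. -/
theorem IsOrnsteinUhlenbeck.exists_ouPath [IsProbabilityMeasure P] (hT : 0 ≤ T) {θ σ : ℝ}
    {σ₀ : ℝ≥0} {W G : ℝ → Ω → ℝ} (hW : IsBrownianMotionOn T W P)
    (hG : IsOrnsteinUhlenbeck θ σ σ₀ T W G P) :
    ∃ (w : ℝ → Lp ℝ 2 P) (x₀ : Lp ℝ 2 P), Continuous w ∧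
      (∀ s ∈ Set.Icc 0 T, ∀ t ∈ Set.Icc 0 T, inner ℝ (w s) (w t) = min s t) ∧
      (∀ t ∈ Set.Icc 0 T, inner ℝ x₀ (w t) = 0) ∧
      ∀ t ∈ Set.Icc 0 T, G t =ᵐ[P] ⇑(ouPath θ (fun t ↦ x₀ + σ • w t) t) := by
  have hG0 : MemLp (G 0) 2 P := hG.initial_law.hasGaussianLaw.memLp_two
  have hmem : ∀ t, (Set.projIcc 0 T hT t : ℝ) ∈ Set.Icc 0 T := fun t ↦ (Set.projIcc 0 T hT t).2
  have hproj : ∀ t ∈ Set.Icc 0 T, (Set.projIcc 0 T hT t : ℝ) = t := fun t ht ↦ by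
    rw [Set.projIcc_of_mem hT ht]
  -- Freezing time outside `[0,T]` makes `w` continuous on all of `ℝ`.
  set w : ℝ → Lp ℝ 2 P := fun t ↦ (hW.memLp (hmem t)).toLp _ with hw
  set x₀ : Lp ℝ 2 P := hG0.toLp _ with hx₀
  have hwc : Continuous w := continuous_of_inner_eq_min
    (r := fun t ↦ (Set.projIcc 0 T hT t : ℝ)) (by fun_prop)
    fun s t ↦ hW.inner_toLp (hmem s) (hmem t)
  have hwW : ∀ t ∈ Set.Icc 0 T, w t =ᵐ[P] W t := by
    intro t ht
    have := (hW.memLp (hmem t)).coeFn_toLp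
    exact this.trans (by rw [hproj t ht])
  refine ⟨w, x₀, hwc, fun s hs t ht ↦ ?_, fun t ht ↦ ?_, fun t ht ↦ ?_⟩
  · rw [hw, hW.inner_toLp (hmem s) (hmem t), hproj s hs, hproj t ht]
  · have hind : IndepFun (G 0) (W (Set.projIcc 0 T hT t)) P :=
      hG.initial_indep.comp measurable_id (measurable_pi_apply (Set.projIcc 0 T hT t))
    rw [hw, hx₀, inner_toLp_toLp, hind.integral_fun_mul_eq_mul_integral hG0.1
      (hW.memLp (hmem t)).1, hW.mean_zero _ (hmem t), mul_zero]
  · have hx : ∀ s ∈ Set.Icc 0 T, ⇑(x₀ + σ • w s) =ᵐ[P] fun ω ↦ G 0 ω + σ * W s ω := by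
      intro s hs
      filter_upwards [Lp.coeFn_add x₀ (σ • w s), Lp.coeFn_smul σ (w s), hwW s hs,
        hG0.coeFn_toLp] with ω e1 e2 e3 e4
      rw [e1, Pi.add_apply, e2, Pi.smul_apply, e3, hx₀, e4, smul_eq_mul]
    have hI := integral_ae_eq_integral_Lp (P := P) ht.1
      (X := fun s ω ↦ Real.exp (θ * s) * (G 0 ω + σ * W s ω))
      (x := fun s ↦ Real.exp (θ * s) • (x₀ + σ • w s)) (Continuous.continuousOn (by fun_prop))
      (fun s hs ↦ by
        filter_upwards [Lp.coeFn_smul (Real.exp (θ * s)) (x₀ + σ • w s),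
          hx s ⟨hs.1, hs.2.trans ht.2⟩] with ω e1 e2
        rw [e1, Pi.smul_apply, e2, smul_eq_mul])
      (by
        filter_upwards [hW.continuousOn] with ω hω
        have := hω.mono (Set.Icc_subset_Icc_right ht.2)
        fun_prop)
    set J : Lp ℝ 2 P := ∫ s in (0 : ℝ)..t, Real.exp (θ * s) • (x₀ + σ • w s) with hJ
    have hγ : ouPath θ (fun t ↦ x₀ + σ • w t) t =
      (x₀ + σ • w t) - θ • (Real.exp (-θ * t) • J) := rfl
    rw [hγ]
    filter_upwards [hI, hx t ht, hG.sde, hG.continuousOn,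
      Lp.coeFn_sub (x₀ + σ • w t) (θ • (Real.exp (-θ * t) • J)),
      Lp.coeFn_smul θ (Real.exp (-θ * t) • J), Lp.coeFn_smul (Real.exp (-θ * t)) J]
      with ω e1 e2 e3 e4 e5 e6 e7
    rw [e5, Pi.sub_apply, e6, Pi.smul_apply, e7, Pi.smul_apply, ← e1, e2, smul_eq_mul, smul_eq_mul]
    exact eq_sub_of_integral_equation (X := fun s ↦ G 0 ω + σ * W s ω) e4
      (fun s hs ↦ by rw [e3 s hs]; ring) ht

theorem StepFunction.integral_ae_eq (f : StepFunction T) {X : ℝ → Ω → ℝ} {γ : ℝ → Lp ℝ 2 P}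
    (h : ∀ t ∈ Set.Icc 0 T, X t =ᵐ[P] γ t) : f.integral X =ᵐ[P] ⇑(f.increments γ) := by
  have h2 : ∀ i, ∀ᵐ ω ∂P, (f.coeff i • (γ (f.right i) - γ (f.left i)) : Lp ℝ 2 P) ω =
      f.coeff i * (X (f.right i) ω - X (f.left i) ω) := by
    intro i
    filter_upwards [Lp.coeFn_smul (f.coeff i) (γ (f.right i) - γ (f.left i)),
      Lp.coeFn_sub (γ (f.right i)) (γ (f.left i)), h _ (f.right_mem i), h _ (f.left_mem i)]
      with ω e1 e2 e3 e4
    rw [e1, Pi.smul_apply, e2, Pi.sub_apply, e3, e4, smul_eq_mul]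
  rw [StepFunction.increments]
  filter_upwards [Lp.coeFn_finsetSum Finset.univ
    fun i ↦ f.coeff i • (γ (f.right i) - γ (f.left i)), ae_all_iff.2 h2] with ω e1 e2
  rw [e1, StepFunction.integral]
  simp only [Finset.sum_apply, e2]

/-- The Wiener integral in terms of `L²` classes. -/
theorem isWienerIntegral_iff {X : ℝ → Ω → ℝ} {γ : ℝ → Lp ℝ 2 P}
    (h : ∀ t ∈ Set.Icc 0 T, X t =ᵐ[P] γ t) {g : ℝ → ℝ}
    (hg : MemLp g 2 (volume.restrict (Set.Icc 0 T))) {Z : Ω → ℝ} (hZ : MemLp Z 2 P) :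
    IsWienerIntegral T X P g Z ↔ ∃ f : ℕ → StepFunction T,
      Tendsto (fun n ↦ (f n).increments (indPath T)) atTop (𝓝 (hg.toLp g)) ∧
      Tendsto (fun n ↦ (f n).increments γ) atTop (𝓝 (hZ.toLp Z)) := by
  have hm : ∀ f : StepFunction T, MemLp (f.integral X) 2 P :=
    fun f ↦ (Lp.memLp _).ae_eq (f.integral_ae_eq h).symm
  have hm' : ∀ f : StepFunction T, (hm f).toLp _ = f.increments γ :=
    fun f ↦ Lp.ext ((hm f).coeFn_toLp.trans (f.integral_ae_eq h))
  rw [IsWienerIntegral, and_iff_right hZ]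
  refine exists_congr fun f ↦ and_congr ?_ ?_
  · simp only [← StepFunction.toLp_toFun]
    exact (Lp.tendsto_Lp_iff_tendsto_eLpNorm'' _ (fun n ↦ (f n).memLp_toFun) g hg).symm
  · simp only [← hm']
    exact (Lp.tendsto_Lp_iff_tendsto_eLpNorm'' _ (fun n ↦ hm (f n)) Z hZ).symm

/-- The bound is applied to the step function `f - f'`. The filter is arbitrary so as to serve both
uniqueness (over `ℕ`) and the Cauchy property (over `ℕ × ℕ`). -/
theorem StepFunction.tendsto_increments_sub {H : Type*} [NormedAddCommGroup H] [NormedSpace ℝ H]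
    {γ : ℝ → H} {C : ℝ}
    (hC : ∀ f : StepFunction T, ‖f.increments γ‖ ≤ C * ‖f.increments (indPath T)‖)
    {ι : Type*} {l : Filter ι} {f f' : ι → StepFunction T}
    (h : Tendsto (fun n ↦ (f n).increments (indPath T) - (f' n).increments (indPath T)) l (𝓝 0)) :
    Tendsto (fun n ↦ (f n).increments γ - (f' n).increments γ) l (𝓝 0) := by
  refine squeeze_zero_norm
    (a := fun n ↦ C * ‖(f n).increments (indPath T) - (f' n).increments (indPath T)‖)
    (fun n ↦ ?_) (by simpa using h.norm.const_mul C)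
  simpa [increments_add, increments_smul, sub_eq_add_neg] using hC ((f n).add ((f' n).smul (-1)))

end OUWiener

end

/-! ### Well-definedness and injectivity of the Wiener integral -/

theorem mainTheorem6 {Ω : Type*} [MeasurableSpace Ω] (P : Measure Ω) [IsProbabilityMeasure P]
    (T : ℝ) (hT : 0 < T) (θ σ : ℝ) (hθ : 0 < θ) (hσ : 0 < σ) (σ₀ : ℝ≥0)
    (W G : ℝ → Ω → ℝ) (hW : OUWiener.IsBrownianMotionOn T W P)
    (hG : OUWiener.IsOrnsteinUhlenbeck θ σ σ₀ T W G P)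
    (g : ℝ → ℝ) (hg : MemLp g 2 (volume.restrict (Set.Icc 0 T))) :
    (∃ Z : Ω → ℝ, OUWiener.IsWienerIntegral T G P g Z) ∧
    (∀ Z Z' : Ω → ℝ, OUWiener.IsWienerIntegral T G P g Z →
      OUWiener.IsWienerIntegral T G P g Z' → Z =ᵐ[P] Z') ∧
    (∀ Z : Ω → ℝ, OUWiener.IsWienerIntegral T G P g Z →
      (Z =ᵐ[P] 0 ↔ g =ᵐ[volume.restrict (Set.Icc 0 T)] 0)) := by
  obtain ⟨w, x₀, hwc, hcov, hx₀, hGγ⟩ := hG.exists_ouPath hT.le hW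
  set γ := OUWiener.ouPath θ (fun t ↦ x₀ + σ • w t) with hγ
  obtain ⟨C, hC⟩ := OUWiener.exists_norm_increments_ouPath_le hwc hcov θ σ x₀
  have huniq : ∀ Z Z' : Ω → ℝ, OUWiener.IsWienerIntegral T G P g Z → OUWiener.IsWienerIntegral T G P g Z' →
      Z =ᵐ[P] Z' := by
    intro Z Z' hZ hZ'
    obtain ⟨f, hf, hfZ⟩ := (OUWiener.isWienerIntegral_iff hGγ hg hZ.1).1 hZ
    obtain ⟨f', hf', hfZ'⟩ := (OUWiener.isWienerIntegral_iff hGγ hg hZ'.1).1 hZ'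
    have h1 := OUWiener.StepFunction.tendsto_increments_sub hC (by simpa using hf.sub hf')
    exact (MemLp.toLp_eq_toLp_iff hZ.1 hZ'.1).1
      (sub_eq_zero.1 (tendsto_nhds_unique (hfZ.sub hfZ') h1))
  refine ⟨?_, huniq, fun Z hZ ↦ ⟨fun hZ0 ↦ ?_, fun hg0 ↦ ?_⟩⟩
  · obtain ⟨f, hf⟩ := OUWiener.exists_seq_increments_tendsto hT.le (hg.toLp g)
    have hcauchy : CauchySeq fun n ↦ (f n).increments γ := by
      rw [cauchySeq_iff_tendsto_dist_atTop_0]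
      have h1 := cauchySeq_iff_tendsto_dist_atTop_0.1 hf.cauchySeq
      simp only [dist_eq_norm] at h1 ⊢
      rw [← tendsto_zero_iff_norm_tendsto_zero] at h1 ⊢
      exact OUWiener.StepFunction.tendsto_increments_sub (f := fun p : ℕ × ℕ ↦ f p.1)
        (f' := fun p ↦ f p.2) hC h1
    obtain ⟨z, hz⟩ := cauchySeq_tendsto_of_complete hcauchy
    refine ⟨z, (OUWiener.isWienerIntegral_iff hGγ hg (Lp.memLp z)).2 ⟨f, hf, ?_⟩⟩
    rwa [Lp.toLp_coeFn]
  · obtain ⟨f, hf, hfZ⟩ := (OUWiener.isWienerIntegral_iff hGγ hg hZ.1).1 hZ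
    have hZ' : hZ.1.toLp Z = 0 := (MemLp.toLp_eq_toLp_iff hZ.1 MemLp.zero).2 hZ0
    rw [hZ'] at hfZ
    have hg' : hg.toLp g = 0 := by
      refine OUWiener.L2Icc_eq_zero_of_inner_covDensity hT.le (θ := θ) hσ.ne' fun t ht ↦ ?_
      -- Pairing with `w t` on the probability side equals pairing with `m` on `L²([0,T])`: by
      -- linearity it suffices to compare single times `b`. Both sides then pass to the limit along
      -- `f`.
      set m := (OUWiener.memLp_covDensity θ σ t T).toLp _ with hm
      have h1 : ∀ f : OUWiener.StepFunction T,
          inner ℝ (f.increments γ) (w t) = inner ℝ (f.increments (OUWiener.indPath T)) m := by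
        intro f
        rw [real_inner_comm, real_inner_comm m]
        have e1 := f.map_increments (innerₛₗ ℝ (w t)) γ
        have e2 := f.map_increments (innerₛₗ ℝ m) (OUWiener.indPath T)
        rw [innerₛₗ_apply_apply] at e1 e2
        rw [e1, e2]
        refine f.increments_congr fun b hb ↦ ?_
        rw [innerₛₗ_apply_apply, innerₛₗ_apply_apply, real_inner_comm, real_inner_comm (OUWiener.indPath T b),
          OUWiener.inner_ouPath hwc hcov hθ.ne' σ hx₀ hb ht, OUWiener.inner_indPath_covDensity hθ.ne' σ hb ht.1]
      have h2 := hfZ.inner (tendsto_const_nhds (x := w t)) (𝕜 := ℝ)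
      simp only [h1, inner_zero_left] at h2
      exact tendsto_nhds_unique (hf.inner tendsto_const_nhds) h2
    exact (MemLp.toLp_eq_toLp_iff hg MemLp.zero).1 hg'
  -- The constant zero sequence exhibits `0` as a Wiener integral of `g`; uniqueness concludes.
  · refine huniq Z 0 hZ ((OUWiener.isWienerIntegral_iff hGγ hg MemLp.zero).2 ⟨fun _ ↦ OUWiener.StepFunction.zero, ?_⟩)
    have hg' : hg.toLp g = 0 := (MemLp.toLp_eq_toLp_iff hg MemLp.zero).2 hg0
    rw [hg', MemLp.toLp_zero]
    simp only [OUWiener.StepFunction.increments_zero]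
    exact ⟨tendsto_const_nhds, tendsto_const_nhds⟩
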